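/- Let $G$ be a finite simple graph with $n$ vertices and let $k\ge 0$ be an integer. A restraint $r$ on $G$ assigns to each vertex $v$ a finite set $r(v)$ of positive integers (forbidden colours); it is a $k$-restraint if $|r(v)|=k$ and $r(v)\subseteq\{1,2,\dots,kn\}$ for every vertex $v$. For an integer $x\ge 0$ let $\pi_r(G,x)$ be the number of maps $c:V(G)\to\{1,\dots,x\}$ such that $c(u)\ne c(v)$ for every edge $uv$ and $c(v)\notin r(v)$ for every vertex $v$. Let $R_{\max}(G,k)$ be the set of $k$-restraints $r$ on $G$ such that, for all sufficiently large $x$, $\pi_{r'}(G,x)\le \pi_r(G,x)$ for every $k$-restraint $r'$ on $G$. Two restraints $r,r'$ are equivalent, $r\simeq r'$, if there are an automorphism $\phi$ of $G$ and a bijection $f:\bigcup_u r(u)\to\bigcup_u r'(u)$ with $f(r(u))=r'(\phi(u))$ for every vertex $u$. If $G$ is bipartite, a $k$-restraint $r$ on $G$ is alternating if there is a bipartition $(V_1,V_2)$ of $G$ (one part may be empty) such that $r$ is constant on $V_1$ and constant on $V_2$, and $r(u)\cap r(v)=\emptyset$ for all $u\in V_1$, $v\in V_2$. Theorem. Let $G$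 be a connected bipartite graph and $k\ge 0$ an integer. Then an alternating $k$-restraint on $G$ exists, and for every alternating $k$-restraint $r_{\mathrm{alt}}$ and every $k$-restraint $r$ on $G$, $$r\in R_{\max}(G,k)\iff r\simeq r_{\mathrm{alt}}.$$ -/

import Mathlib

/-! Restraints on a finite simple graph `G`: each vertex `v` gets a finite set `r v` of forbidden
colours; colours are positive integers. -/

namespace Restraint

/-- The proper colourings of `G` with colours `1, …, x` that are permitted by the restraint `r`. -/
def permittedColourings {V : Type*} (G : SimpleGraph V) (r : V → Finset ℕ) (x : ℕ) :
    Set (V → ℕ) :=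
  {c | (∀ v, c v ∈ Finset.Icc 1 x) ∧ (∀ u v, G.Adj u v → c u ≠ c v) ∧ ∀ v, c v ∉ r v}

/-- The restrained chromatic polynomial `π_r(G, x)`: the number of proper `x`-colourings of `G`
permitted by `r` (a finite number when `V` is finite). -/
noncomputable def numPermitted {V : Type*} (G : SimpleGraph V) (r : V → Finset ℕ) (x : ℕ) : ℕ :=
  (permittedColourings G r x).ncard

/-- `r` is a `k`-restraint: `|r(v)| = k` and `r(v) ⊆ {1, …, kn}` for each of the `n` vertices. -/
def IsKRestraint {V : Type*} [Fintype V] (k : ℕ) (r : V → Finset ℕ) : Prop :=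
  ∀ v, (r v).card = k ∧ r v ⊆ Finset.Icc 1 (k * Fintype.card V)

/-- `R_max(G, k)`: the `k`-restraints that, for all sufficiently large `x`, permit the largest
number of `x`-colourings among all `k`-restraints. -/
def Rmax {V : Type*} [Fintype V] (G : SimpleGraph V) (k : ℕ) : Set (V → Finset ℕ) :=
  {r | IsKRestraint k r ∧
    ∃ N : ℕ, ∀ x : ℕ, N ≤ x → ∀ r' : V → Finset ℕ, IsKRestraint k r' →
      numPermitted G r' x ≤ numPermitted G r x}

/-- The set `r(G)` of all colours used by `r`. -/
def colours {V : Type*} (r : V → Finset ℕ) : Set ℕ := {i | ∃ v, i ∈ r v}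

/-- `r ≃ r'`: there are an automorphism `φ` of `G` and a bijection `f : r(G) → r'(G)` with
`f(r(u)) = r'(φ(u))` for every vertex `u` (only the values of `f` on `r(G)` matter). -/
def Equivalent {V : Type*} (G : SimpleGraph V) (r r' : V → Finset ℕ) : Prop :=
  ∃ φ : G ≃g G, ∃ f : ℕ → ℕ, Set.BijOn f (colours r) (colours r') ∧
    ∀ u, (r u).image f = r' (φ u)

/-- `(V₁, V₂)` is a bipartition of `G`; one of the parts may be empty. -/
def IsBipartition {V : Type*} (G : SimpleGraph V) (V₁ V₂ : Set V) : Prop :=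
  V₁ ∪ V₂ = Set.univ ∧ G.IsBipartiteWith V₁ V₂

/-- `r` is an alternating `k`-restraint: constant on each part of a bipartition of `G`, with
disjoint values on the two parts. -/
def IsAlternating {V : Type*} [Fintype V] (G : SimpleGraph V) (k : ℕ) (r : V → Finset ℕ) : Prop :=
  IsKRestraint k r ∧ ∃ V₁ V₂ : Set V, IsBipartition G V₁ V₂ ∧
    (∀ a ∈ V₁, ∀ a' ∈ V₁, r a = r a') ∧ (∀ a ∈ V₂, ∀ a' ∈ V₂, r a = r a') ∧
    ∀ u ∈ V₁, ∀ v ∈ V₂, r u ∩ r v = ∅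

end Restraint

/-! For `x ≥ kn`, inclusion-exclusion over edge sets gives `π_r(G, x) = ∑_A (-1)^|A| ∏_C (x - |⋃_{v
∈ C} r(v)|)`, with `C` running over the components of `(V, A)`; the restraint enters only through
the sizes of these unions. A bipartite graph has no triangle, so at most three edges always form a
forest, and a set of `j ≤ 3` edges has `n - j` components.

Hence `r` first matters in the coefficient of `x^(n-2)`. There each edge `uv` contributes `+|r(u) ∪
r(v)|`, up to terms independent of `r`, so adjacent vertices should have disjoint restraints
(`eventually_pos_of_not_disjoint`). Once they do, the coefficient of `x^(n-3)` varies only through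
pairs of edges, now with a minus sign. A path `u, v, w` has a union of at least `2k` colours, with
equality iff `r(u) = r(w)` (`eventually_pos_of_ne`).

Restraints with both properties (`LocallyAlternating`) have unions of size `2k` on every component
with an edge, so they share one polynomial and eventually beat all others. By connectedness they
take at most two values, so a relabelling of colours carries any one to any other
(`LocallyAlternating.equivalent`). -/

namespace Restraint

/-- The connected components of the spanning subgraph with edge set `A`. -/
abbrev Comp {V : Type*} (A : Finset (Sym2 V)) : Type _ :=
  (SimpleGraph.fromEdgeSet (A : Set (Sym2 V))).ConnectedComponent

/-- The component of a vertex in the spanning subgraph with edge set `A`. -/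
abbrev comp {V : Type*} (A : Finset (Sym2 V)) (v : V) : Comp A :=
  (SimpleGraph.fromEdgeSet (A : Set (Sym2 V))).connectedComponentMk v

/-! ### Components of spanning subgraphs with few edges -/

section Components

open scoped Classical

variable {V : Type*}

theorem comp_surjective (A : Finset (Sym2 V)) : Function.Surjective (comp A) :=
  Quot.mk_surjective

theorem comp_eq_of_mem {A : Finset (Sym2 V)} {u v : V} (h : s(u, v) ∈ A) :
    comp A u = comp A v := by
  by_cases huv : u = v
  · rw [huv]
  · refine SimpleGraph.ConnectedComponent.sound (SimpleGraph.Adj.reachable ?_)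
    simpa [SimpleGraph.fromEdgeSet_adj] using ⟨h, huv⟩

/-- A function constant along the edges in `A` is constant on components. -/
theorem eq_of_comp_eq {W : Type*} {A : Finset (Sym2 V)} {f : V → W}
    (hf : ∀ u v, s(u, v) ∈ A → f u = f v) {u v : V} (h : comp A u = comp A v) : f u = f v := by
  obtain ⟨p⟩ := SimpleGraph.ConnectedComponent.exact h
  induction p with
  | nil => rfl
  | cons hadj p ih =>
    rw [SimpleGraph.fromEdgeSet_adj] at hadj
    exact (hf _ _ (by simpa using hadj.1)).trans
      (ih (SimpleGraph.ConnectedComponent.sound p.reachable))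

theorem comp_singleton_eq {u v w : V} (h : comp {s(u, v)} w = comp {s(u, v)} v) :
    w = u ∨ w = v := by
  have := eq_of_comp_eq (A := {s(u, v)}) (f := fun w => if w = u then v else w) (by
      intro a b hab
      simp only [Finset.mem_singleton, Sym2.eq_iff] at hab
      grind) h
  grind

/-- A component either consists of one vertex or contains an edge. -/
theorem comp_subsingleton_or_edge {A : Finset (Sym2 V)} (C : Comp A) :
    (∃ v, ∀ w, comp A w = C ↔ w = v) ∨
      ∃ u v, s(u, v) ∈ A ∧ u ≠ v ∧ comp A u = C ∧ comp A v = C := by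
  obtain ⟨v, rfl⟩ := comp_surjective A C
  by_cases hv : ∃ w, s(v, w) ∈ A ∧ v ≠ w
  · obtain ⟨w, hw, hne⟩ := hv
    exact Or.inr ⟨v, w, hw, hne, rfl, (comp_eq_of_mem hw).symm⟩
  · refine Or.inl ⟨v, fun w => ⟨fun hw => ?_, fun hw => by rw [hw]⟩⟩
    push Not at hv
    have := eq_of_comp_eq (A := A) (f := fun z => z = v) (by
      intro a b hab
      have h1 := hv b
      have h2 := hv a
      rw [Sym2.eq_swap] at h2
      grind) hw
    simpa using this

variable [Fintype V]

theorem card_le_card_comp {W : Type*} {A : Finset (Sym2 V)} {f : V → W} {T : Finset V}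
    (hf : ∀ u v, s(u, v) ∈ A → f u = f v) (hT : Set.InjOn f T) :
    T.card ≤ Fintype.card (Comp A) := by
  rw [← Finset.card_univ]
  refine Finset.card_le_card_of_injOn (comp A) (fun _ _ => Finset.mem_coe.2 (Finset.mem_univ _)) ?_
  intro a ha b hb hab
  exact hT ha hb (eq_of_comp_eq hf hab)

theorem card_comp_mono {A B : Finset (Sym2 V)} (h : A ⊆ B) :
    Fintype.card (Comp B) ≤ Fintype.card (Comp A) := by
  have hle : SimpleGraph.fromEdgeSet (A : Set (Sym2 V)) ≤ SimpleGraph.fromEdgeSet B :=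
    SimpleGraph.fromEdgeSet_mono (by exact_mod_cast h)
  exact Fintype.card_le_of_surjective _ (SimpleGraph.ConnectedComponent.surjective_map_ofLE hle)

/-- A path in `A` joining the ends of an edge of `G` has odd length by bipartiteness and length at
most 2, so it is that edge. -/
theorem mem_of_comp_eq {G : SimpleGraph V} (hbip : G.IsBipartite) {A : Finset (Sym2 V)}
    (hA : A ⊆ G.edgeFinset) (hcard : A.card ≤ 2) {u v : V} (hadj : G.Adj u v)
    (h : comp A u = comp A v) : s(u, v) ∈ A := by
  have c : G.Coloring Bool := hbip.toColoring (by simp)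
  have hle : SimpleGraph.fromEdgeSet (A : Set (Sym2 V)) ≤ G := by
    intro a b hab
    rw [SimpleGraph.fromEdgeSet_adj] at hab
    simpa using hA hab.1
  obtain ⟨p, hp⟩ := (SimpleGraph.ConnectedComponent.exact h).exists_isPath
  have hlen : p.length ≤ 2 := by
    refine (hp.isTrail.length_le_card_edgeFinset).trans (le_trans (Finset.card_le_card ?_) hcard)
    intro e he
    simp only [SimpleGraph.mem_edgeFinset, SimpleGraph.edgeSet_fromEdgeSet] at he
    exact he.1
  have hodd : Odd p.length := by
    have := (c.odd_length_iff_not_congr (p.mapLe hle)).2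
      (by have := c.valid hadj; revert this; cases c u <;> cases c v <;> simp)
    simpa using this
  have hone : p.length = 1 := by
    obtain ⟨m, hm⟩ := hodd
    omega
  have := SimpleGraph.Walk.adj_of_length_eq_one hone
  rw [SimpleGraph.fromEdgeSet_adj] at this
  exact this.1

theorem card_comp_insert_lt {G : SimpleGraph V} (hbip : G.IsBipartite) {A : Finset (Sym2 V)}
    (hA : A ⊆ G.edgeFinset) (hcard : A.card ≤ 2) {e : Sym2 V} (he : e ∈ G.edgeFinset)
    (heA : e ∉ A) : Fintype.card (Comp (insert e A)) < Fintype.card (Comp A) := by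
  induction e with | _ u v
  have hle : SimpleGraph.fromEdgeSet (A : Set (Sym2 V)) ≤
      SimpleGraph.fromEdgeSet (insert s(u, v) A : Finset (Sym2 V)) :=
    SimpleGraph.fromEdgeSet_mono (by simp)
  refine Fintype.card_lt_of_surjective_not_injective _
    (SimpleGraph.ConnectedComponent.surjective_map_ofLE hle) fun hinj => heA ?_
  refine mem_of_comp_eq hbip hA hcard (by simpa using he) (hinj ?_)
  exact comp_eq_of_mem (A := insert s(u, v) A) (Finset.mem_insert_self _ _)

/-- The bound 3 is sharp: a 4-cycle has four edges but only three fewer components than vertices. -/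
theorem card_comp_add_card_le {G : SimpleGraph V} (hbip : G.IsBipartite) (A : Finset (Sym2 V)) :
    A ⊆ G.edgeFinset → A.card ≤ 3 → Fintype.card (Comp A) + A.card ≤ Fintype.card V := by
  induction A using Finset.induction_on with
  | empty => intro _ _; simpa using Fintype.card_le_of_surjective _ (comp_surjective ∅)
  | insert e A heA ih =>
    intro hA hcard
    rw [Finset.card_insert_of_notMem heA] at hcard ⊢
    rw [Finset.insert_subset_iff] at hA
    have := ih hA.2 (by omega)
    have := card_comp_insert_lt hbip hA.2 (by omega) hA.1 heA
    omega

theorem card_comp_add_le {G : SimpleGraph V} (hbip : G.IsBipartite) {A : Finset (Sym2 V)}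
    (hA : A ⊆ G.edgeFinset) {j : ℕ} (hj : j ≤ A.card) (hj3 : j ≤ 3) :
    Fintype.card (Comp A) + j ≤ Fintype.card V := by
  obtain ⟨B, hBA, hB⟩ := Finset.exists_subset_card_eq hj
  have h1 := card_comp_add_card_le hbip B (hBA.trans hA) (by omega)
  have h2 := card_comp_mono hBA
  omega

theorem card_le_card_comp_singleton (u v : V) :
    Fintype.card V ≤ Fintype.card (Comp {s(u, v)}) + 1 := by
  -- Collapsing `u` onto `v` is constant along the edge and still separates all vertices other than
  -- `u`.
  have h := card_le_card_comp (A := {s(u, v)}) (f := fun w => if w = u then v else w)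
    (T := Finset.univ.erase u) (by
      intro a b hab
      simp only [Finset.mem_singleton, Sym2.eq_iff] at hab
      grind) (by
      intro a ha b hb hab
      simp only [Finset.coe_erase, Finset.coe_univ, Set.mem_sdiff, Set.mem_singleton_iff] at ha hb
      simpa [ha.2, hb.2] using hab)
  rw [Finset.card_erase_of_mem (Finset.mem_univ _), Finset.card_univ] at h
  omega

theorem card_le_card_comp_pair (u v w : V) :
    Fintype.card V ≤ Fintype.card (Comp {s(u, v), s(w, v)}) + 2 := by
  have h := card_le_card_comp (A := {s(u, v), s(w, v)})
    (f := fun z => if z = u ∨ z = w then v else z)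
    (T := (Finset.univ.erase u).erase w) (by
      intro a b hab
      simp only [Finset.mem_insert, Finset.mem_singleton, Sym2.eq_iff] at hab
      grind) (by
      intro a ha b hb hab
      simp only [Finset.coe_erase, Finset.coe_univ, Set.mem_sdiff, Set.mem_singleton_iff] at ha hb
      simpa [ha.1.2, hb.1.2, ha.2, hb.2] using hab)
  have h1 := Finset.pred_card_le_card_erase (s := Finset.univ.erase u) (a := w)
  rw [Finset.card_erase_of_mem (Finset.mem_univ u), Finset.card_univ] at h1
  omega

end Components

end Restraint

namespace Restraint

/-! ### The restrained chromatic polynomial and its coefficients -/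

section Polynomials

open scoped Classical
open Polynomial

variable {V : Type*} [Fintype V]

/-- The colours forbidden somewhere on the component `C`. -/
noncomputable def compUnion (A : Finset (Sym2 V)) (r : V → Finset ℕ) (C : Comp A) : Finset ℕ :=
  (Finset.univ.filter fun v => comp A v = C).biUnion r

theorem mem_compUnion {A : Finset (Sym2 V)} {r : V → Finset ℕ} {C : Comp A} {i : ℕ} :
    i ∈ compUnion A r C ↔ ∃ v, comp A v = C ∧ i ∈ r v := by
  simp [compUnion]

theorem subset_compUnion {A : Finset (Sym2 V)} (r : V → Finset ℕ) {C : Comp A} {v : V}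
    (h : comp A v = C) : r v ⊆ compUnion A r C :=
  fun _ hi => mem_compUnion.2 ⟨v, h, hi⟩

/-- For large `x`, the number of maps to `{1, …, x}` permitted by `r` and constant along `A`. -/
noncomputable def compPoly (A : Finset (Sym2 V)) (r : V → Finset ℕ) : ℝ[X] :=
  ∏ C : Comp A, (X - Polynomial.C ((compUnion A r C).card : ℝ))

theorem compPoly_natDegree (A : Finset (Sym2 V)) (r : V → Finset ℕ) :
    (compPoly A r).natDegree = Fintype.card (Comp A) := by
  rw [compPoly, natDegree_finsetProd_X_sub_C_eq_card, Finset.card_univ]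

theorem compPoly_monic (A : Finset (Sym2 V)) (r : V → Finset ℕ) : (compPoly A r).Monic :=
  monic_prod_X_sub_C _ _

/-- Both polynomials are monic of the same degree, so their leading terms cancel. -/
theorem compPoly_sub_coeff_of_le {A : Finset (Sym2 V)} {r s : V → Finset ℕ} {i : ℕ}
    (h : Fintype.card (Comp A) ≤ i) : (compPoly A s - compPoly A r).coeff i = 0 := by
  rw [coeff_sub]
  rcases h.eq_or_lt with rfl | h
  · have h1 := (compPoly_monic A s).coeff_natDegree
    have h2 := (compPoly_monic A r).coeff_natDegree
    rw [compPoly_natDegree] at h1 h2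
    rw [h1, h2, sub_self]
  · rw [coeff_eq_zero_of_natDegree_lt (by rwa [compPoly_natDegree]),
      coeff_eq_zero_of_natDegree_lt (by rwa [compPoly_natDegree]), sub_self]

theorem compPoly_coeff_of_card_eq {A : Finset (Sym2 V)} {r : V → Finset ℕ} {i : ℕ}
    (h : Fintype.card (Comp A) = i + 1) :
    (compPoly A r).coeff i = -∑ C : Comp A, ((compUnion A r C).card : ℝ) := by
  rw [← prod_X_sub_C_nextCoeff, ← compPoly, nextCoeff_of_natDegree_pos, compPoly_natDegree, h]
  · simp
  · rw [compPoly_natDegree, h]; omega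

theorem compPoly_sub_coeff_nonneg {A : Finset (Sym2 V)} {r s : V → Finset ℕ} {i : ℕ}
    (h : Fintype.card (Comp A) ≤ i + 1)
    (hle : ∀ C : Comp A, (compUnion A s C).card ≤ (compUnion A r C).card) :
    0 ≤ (compPoly A s - compPoly A r).coeff i := by
  rcases h.eq_or_lt with h | h
  · rw [coeff_sub, compPoly_coeff_of_card_eq h, compPoly_coeff_of_card_eq h]
    have : ∑ C : Comp A, ((compUnion A s C).card : ℝ) ≤
        ∑ C : Comp A, ((compUnion A r C).card : ℝ) :=
      Finset.sum_le_sum fun C _ => by exact_mod_cast hle C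
    linarith
  · rw [compPoly_sub_coeff_of_le (by omega)]

theorem compPoly_sub_coeff_pos {A : Finset (Sym2 V)} {r s : V → Finset ℕ} {i : ℕ}
    (h : Fintype.card (Comp A) = i + 1)
    (hle : ∀ C : Comp A, (compUnion A s C).card ≤ (compUnion A r C).card)
    (C : Comp A) (hlt : (compUnion A s C).card < (compUnion A r C).card) :
    0 < (compPoly A s - compPoly A r).coeff i := by
  rw [coeff_sub, compPoly_coeff_of_card_eq h, compPoly_coeff_of_card_eq h]
  have : ∑ C : Comp A, ((compUnion A s C).card : ℝ) <
      ∑ C : Comp A, ((compUnion A r C).card : ℝ) :=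
    Finset.sum_lt_sum (fun C _ => by exact_mod_cast hle C)
      ⟨C, Finset.mem_univ _, by exact_mod_cast hlt⟩
  linarith

theorem compPoly_eq_of_card_eq {A : Finset (Sym2 V)} {r s : V → Finset ℕ}
    (h : ∀ C : Comp A, (compUnion A s C).card = (compUnion A r C).card) :
    compPoly A s = compPoly A r := by
  simp only [compPoly, h]

/-- The restrained chromatic polynomial, by inclusion-exclusion over edge sets. -/
noncomputable def restrainedPoly (G : SimpleGraph V) (r : V → Finset ℕ) : ℝ[X] :=
  ∑ A ∈ G.edgeFinset.powerset, (-1) ^ A.card * compPoly A r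

theorem restrainedPoly_sub_coeff (G : SimpleGraph V) (r s : V → Finset ℕ) (i : ℕ) :
    (restrainedPoly G s - restrainedPoly G r).coeff i =
      ∑ A ∈ G.edgeFinset.powerset,
        (-1) ^ A.card * (compPoly A s - compPoly A r).coeff i := by
  rw [restrainedPoly, restrainedPoly, ← Finset.sum_sub_distrib, finsetSum_coeff]
  refine Finset.sum_congr rfl fun A _ => ?_
  rw [← mul_sub]
  have : ((-1) ^ A.card : ℝ[X]) = Polynomial.C ((-1) ^ A.card) := by simp
  rw [this, coeff_C_mul]

theorem eventually_eval_pos {p : ℝ[X]} {m : ℕ} (hpos : 0 < p.coeff m)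
    (hzero : ∀ i, m < i → p.coeff i = 0) : ∀ᶠ x : ℕ in Filter.atTop, 0 < p.eval (x : ℝ) := by
  have hdeg : p.natDegree = m :=
    le_antisymm (natDegree_le_iff_coeff_eq_zero.2 hzero) (le_natDegree_of_ne_zero hpos.ne')
  -- A constant does not tend to infinity, so degree 0 is separate.
  rcases Nat.eq_zero_or_pos m with rfl | hm
  · rw [eq_C_of_natDegree_eq_zero hdeg]
    exact Filter.Eventually.of_forall fun x => by simpa using hpos
  · have hlead : 0 ≤ p.leadingCoeff := by
      rw [leadingCoeff, hdeg]; exact hpos.le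
    have := (p.tendsto_atTop_of_leadingCoeff_nonneg
      (natDegree_pos_iff_degree_pos.1 (by omega)) hlead).comp tendsto_natCast_atTop_atTop
    exact this.eventually_gt_atTop 0

/-- The number of maps permitted by `r` and constant on the edges in `A`. -/
theorem card_filter_constant (A : Finset (Sym2 V)) {r : V → Finset ℕ} {x : ℕ}
    (hx : ∀ v, r v ⊆ Finset.Icc 1 x) :
    (((Fintype.piFinset fun v => Finset.Icc 1 x \ r v).filter
      fun c => ∀ e ∈ A, (e.map c).IsDiag).card : ℝ) = (compPoly A r).eval (x : ℝ) := by
  have hcard : (Fintype.piFinset fun C : Comp A => Finset.Icc 1 x \ compUnion A r C).card =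
      ((Fintype.piFinset fun v => Finset.Icc 1 x \ r v).filter
        fun c => ∀ e ∈ A, (e.map c).IsDiag).card := by
    refine Finset.card_bij (fun g _ v => g (comp A v)) ?_ ?_ ?_
    · intro g hg
      simp only [Fintype.mem_piFinset, Finset.mem_sdiff, mem_compUnion] at hg
      simp only [Finset.mem_filter, Fintype.mem_piFinset, Finset.mem_sdiff]
      refine ⟨fun v => ⟨(hg _).1, fun hv => (hg _).2 ⟨v, rfl, hv⟩⟩, fun e he => ?_⟩
      induction e with | _ u v
      simp [comp_eq_of_mem he]
    · intro g _ g' _ h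
      funext C
      obtain ⟨v, rfl⟩ := comp_surjective A C
      exact congrFun h v
    · intro c hc
      simp only [Finset.mem_filter, Fintype.mem_piFinset, Finset.mem_sdiff] at hc
      have hconst : ∀ u v, s(u, v) ∈ A → c u = c v := fun u v h => by simpa using hc.2 _ h
      have hrep : ∀ v, c (Function.surjInv (comp_surjective A) (comp A v)) = c v := fun v =>
        eq_of_comp_eq hconst (Function.surjInv_eq (comp_surjective A) _)
      -- The value on a component is read off at an arbitrary representative.
      refine ⟨fun C => c (Function.surjInv (comp_surjective A) C), ?_, funext hrep⟩
      simp only [Fintype.mem_piFinset, Finset.mem_sdiff, mem_compUnion]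
      refine fun C => ⟨(hc.1 _).1, ?_⟩
      rintro ⟨v, rfl, hv⟩
      rw [hrep] at hv
      exact (hc.1 v).2 hv
  rw [← hcard, Fintype.card_piFinset, compPoly, eval_prod, Nat.cast_prod]
  refine Finset.prod_congr rfl fun C _ => ?_
  -- Every forbidden colour lies in the palette, so exactly `x - |compUnion|` colours remain.
  have hsub : compUnion A r C ⊆ Finset.Icc 1 x := by
    intro i hi
    obtain ⟨v, _, hv⟩ := mem_compUnion.1 hi
    exact hx v hv
  rw [Finset.card_sdiff_of_subset hsub, Nat.cast_sub (Finset.card_le_card hsub)]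
  simp

theorem numPermitted_eq_eval (G : SimpleGraph V) {r : V → Finset ℕ} {x : ℕ}
    (hx : ∀ v, r v ⊆ Finset.Icc 1 x) :
    (numPermitted G r x : ℝ) = (restrainedPoly G r).eval (x : ℝ) := by
  have hset : permittedColourings G r x =
      ((Fintype.piFinset fun v => Finset.Icc 1 x \ r v).filter
        fun c => ∀ e ∈ G.edgeFinset, ¬ (e.map c).IsDiag : Finset (V → ℕ)) := by
    ext c
    simp only [permittedColourings, Set.mem_ofPred_eq, Finset.coe_filter, Fintype.mem_piFinset,
      Finset.mem_sdiff, Sym2.forall, SimpleGraph.mem_edgeFinset, SimpleGraph.mem_edgeSet,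
      Sym2.map_mk, Sym2.mk_isDiag_iff]
    constructor
    · rintro ⟨h1, h2, h3⟩
      exact ⟨fun v => ⟨h1 v, h3 v⟩, h2⟩
    · rintro ⟨h1, h2⟩
      exact ⟨fun v => (h1 v).1, h2, fun v => (h1 v).2⟩
  rw [numPermitted, hset, Set.ncard_coe_finset, Finset.card_filter, Nat.cast_sum]
  -- Inclusion-exclusion: expand the product over edges of `1 - [c is constant on e]`.
  have hterm : ∀ c : V → ℕ, (((if ∀ e ∈ G.edgeFinset, ¬ (e.map c).IsDiag then 1 else 0 : ℕ)) : ℝ) =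
      ∑ A ∈ G.edgeFinset.powerset,
        (-1) ^ A.card * (if ∀ e ∈ A, (e.map c).IsDiag then (1 : ℝ) else 0) := by
    intro c
    have h := Finset.prod_sub (fun _ => (1 : ℝ)) (fun e : Sym2 V => if (e.map c).IsDiag then 1 else 0)
      G.edgeFinset
    simp only [Finset.prod_const_one, mul_one, Finset.prod_ite_zero] at h
    rw [← h]
    have h2 : ∀ e : Sym2 V, (1 - if (e.map c).IsDiag then (1 : ℝ) else 0) =
        if ¬ (e.map c).IsDiag then 1 else 0 := by
      intro e; split_ifs <;> simp_all
    simp only [h2, Finset.prod_ite_zero, Finset.prod_const_one]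
    push_cast
    rfl
  simp only [hterm]
  rw [Finset.sum_comm, restrainedPoly, eval_finsetSum]
  refine Finset.sum_congr rfl fun A _ => ?_
  rw [← Finset.mul_sum, eval_mul, ← card_filter_constant A hx, Finset.card_filter]
  simp

end Polynomials

end Restraint

namespace Restraint

/-- Adjacent vertices have disjoint restraints, and vertices with a common neighbour have equal
ones. In a connected bipartite graph this is a local form of alternation. -/
structure LocallyAlternating {V : Type*} (G : SimpleGraph V) (r : V → Finset ℕ) : Prop where
  disjoint : ∀ u v, G.Adj u v → Disjoint (r u) (r v)
  eq : ∀ u v w, G.Adj u v → G.Adj w v → r u = r w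

/-! ### Local alternation, equivalence and existence -/

section Extremal

open scoped Classical

variable {V : Type*}

/-- A function taking equal values at vertices with a common neighbour takes at most two values. -/
theorem eq_or_eq_of_adj {β : Type*} {G : SimpleGraph V} (hconn : G.Connected) {g : V → β}
    (hg : ∀ u v w, G.Adj u v → G.Adj w v → g u = g w) {u v : V} (huv : G.Adj u v) (w : V) :
    g w = g u ∨ g w = g v := by
  -- The invariant along a walk also records the common value at the neighbours, so each step swaps
  -- the two values.
  have key : ∀ a b, G.Walk a b →
      ((g a = g u ∧ ∀ z, G.Adj z a → g z = g v) ∨ (g a = g v ∧ ∀ z, G.Adj z a → g z = g u)) →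
      ((g b = g u ∧ ∀ z, G.Adj z b → g z = g v) ∨ (g b = g v ∧ ∀ z, G.Adj z b → g z = g u)) := by
    intro a b p
    induction p with
    | nil => exact id
    | @cons a c b hac p ih =>
      rintro (⟨h1, h2⟩ | ⟨h1, h2⟩)
      · exact ih (Or.inr ⟨h2 _ hac.symm, fun z hz => (hg _ _ _ hz hac).trans h1⟩)
      · exact ih (Or.inl ⟨h2 _ hac.symm, fun z hz => (hg _ _ _ hz hac).trans h1⟩)
  obtain ⟨p⟩ := hconn.preconnected u w
  rcases key u w p (Or.inl ⟨rfl, fun z hz => hg _ _ _ hz huv.symm⟩) with h | h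
  · exact Or.inl h.1
  · exact Or.inr h.1

theorem IsAlternating.locallyAlternating [Fintype V] {G : SimpleGraph V} {k : ℕ}
    {r : V → Finset ℕ} (h : IsAlternating G k r) : LocallyAlternating G r := by
  obtain ⟨_, V₁, V₂, ⟨_, hb⟩, h1, h2, h12⟩ := h
  constructor
  · intro u v huv
    rcases hb.mem_of_adj huv with ⟨hu, hv⟩ | ⟨hu, hv⟩
    · exact Finset.disjoint_iff_inter_eq_empty.2 (h12 u hu v hv)
    · exact (Finset.disjoint_iff_inter_eq_empty.2 (h12 v hv u hu)).symm
  · intro u v w huv hwv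
    have hd : ∀ z ∈ V₁, z ∉ V₂ := fun _ hz => Set.disjoint_left.1 hb.disjoint hz
    rcases hb.mem_of_adj huv with ⟨hu, hv⟩ | ⟨hu, hv⟩ <;>
      rcases hb.mem_of_adj hwv with ⟨hw, hv'⟩ | ⟨hw, hv'⟩
    · exact h1 u hu w hw
    · exact absurd hv (hd v hv')
    · exact absurd hv' (hd v hv)
    · exact h2 u hu w hw

theorem Equivalent.locallyAlternating {G : SimpleGraph V} {r s : V → Finset ℕ}
    (h : Equivalent G r s) (hs : LocallyAlternating G s) : LocallyAlternating G r := by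
  obtain ⟨φ, f, hf, hfr⟩ := h
  constructor
  · intro u v huv
    have := hs.disjoint _ _ (φ.map_adj_iff.2 huv)
    rw [← hfr, ← hfr] at this
    exact this.of_image_finset
  · intro u v w huv hwv
    have := hs.eq _ _ _ (φ.map_adj_iff.2 huv) (φ.map_adj_iff.2 hwv)
    rw [← hfr u, ← hfr w] at this
    have hsub : ∀ z, (r z : Set ℕ) ⊆ colours r := fun z i hi => ⟨z, hi⟩
    have := congrArg (fun t : Finset ℕ => (t : Set ℕ)) this
    simp only [Finset.coe_image] at this
    -- `f` is injective only on the colours of `r`, which is enough to cancel it here.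
    exact_mod_cast (hf.injOn.image_eq_image_iff (hsub u) (hsub w)).1 this

theorem exists_injOn_image {S T S' T' : Finset ℕ} (hST : Disjoint S T) (hST' : Disjoint S' T')
    (hS : S.card = S'.card) (hT : T.card = T'.card) :
    ∃ f : ℕ → ℕ, Set.InjOn f (S ∪ T : Finset ℕ) ∧ S.image f = S' ∧ T.image f = T' := by
  obtain ⟨f, hf⟩ := S.finite_toSet.exists_bijOn_of_encard_eq
    (t := (S' : Set ℕ)) (by simp [Set.encard_coe_eq_coe_finsetCard, hS])
  obtain ⟨g, hg⟩ := T.finite_toSet.exists_bijOn_of_encard_eq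
    (t := (T' : Set ℕ)) (by simp [Set.encard_coe_eq_coe_finsetCard, hT])
  have hfS : S.image f = S' := by exact_mod_cast hf.image_eq
  have hgT : T.image g = T' := by exact_mod_cast hg.image_eq
  have hnS : ∀ i ∈ T, i ∉ S := fun i hi hi' => Finset.disjoint_left.1 hST hi' hi
  refine ⟨fun i => if i ∈ S then f i else g i, ?_, ?_, ?_⟩
  · have hne : ∀ i ∈ S, ∀ j ∈ T, f i ≠ g j := fun i hi j hj h =>
      Finset.disjoint_left.1 hST' (hf.mapsTo hi) (h ▸ hg.mapsTo hj)
    intro i hi j hj hij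
    rw [Finset.mem_coe, Finset.mem_union] at hi hj
    by_cases hiS : i ∈ S <;> by_cases hjS : j ∈ S <;> simp only [hiS, hjS, if_true, if_false] at hij
    · exact hf.injOn hiS hjS hij
    · exact absurd hij (hne i hiS j (hj.resolve_left hjS))
    · exact absurd hij.symm (hne j hjS i (hi.resolve_left hiS))
    · exact hg.injOn (hi.resolve_left hiS) (hj.resolve_left hjS) hij
  · rw [← hfS]
    exact Finset.image_congr fun i hi => if_pos hi
  · rw [← hgT]
    exact Finset.image_congr fun i hi => if_neg (hnS i hi)

theorem LocallyAlternating.equivalent [Fintype V] {G : SimpleGraph V} (hconn : G.Connected)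
    {k : ℕ} {r s : V → Finset ℕ} (hrk : IsKRestraint k r) (hsk : IsKRestraint k s)
    (hr : LocallyAlternating G r) (hs : LocallyAlternating G s) : Equivalent G r s := by
  obtain ⟨f, hinj, him⟩ : ∃ f : ℕ → ℕ, Set.InjOn f (colours r) ∧ ∀ u, (r u).image f = s u := by
    by_cases hadj : ∃ u v, G.Adj u v
    · obtain ⟨u, v, huv⟩ := hadj
      obtain ⟨f, hf, hfu, hfv⟩ := exists_injOn_image (hr.disjoint u v huv) (hs.disjoint u v huv)
        ((hrk u).1.trans (hsk u).1.symm) ((hrk v).1.trans (hsk v).1.symm)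
      -- Working with pairs makes `r` and `s` switch values at the same vertices, so `φ` can be the
      -- identity.
      have hval := eq_or_eq_of_adj hconn (g := fun w => (r w, s w))
        (fun a b c hab hcb => Prod.ext (hr.eq a b c hab hcb) (hs.eq a b c hab hcb)) huv
      simp only [Prod.mk.injEq] at hval
      refine ⟨f, hf.mono ?_, fun w => ?_⟩
      · rintro i ⟨w, hw⟩
        rcases hval w with ⟨h, _⟩ | ⟨h, _⟩ <;> rw [h] at hw <;> simp [hw]
      · rcases hval w with ⟨h1, h2⟩ | ⟨h1, h2⟩ <;> rw [h1, h2] <;> assumption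
    · push Not at hadj
      obtain ⟨u⟩ := hconn.nonempty
      have huniq : ∀ w, w = u := by
        intro w
        obtain ⟨p⟩ := hconn.preconnected w u
        cases p with
        | nil => rfl
        | cons h _ => exact absurd h (hadj _ _)
      obtain ⟨f, hf, hfu, -⟩ := exists_injOn_image (Finset.disjoint_empty_right (r u))
        (Finset.disjoint_empty_right (s u)) ((hrk u).1.trans (hsk u).1.symm) rfl
      refine ⟨f, hf.mono ?_, fun w => by rw [huniq w, hfu]⟩
      rintro i ⟨w, hw⟩
      rw [huniq w] at hw
      simpa using hw
  refine ⟨SimpleGraph.Iso.refl, f, ⟨?_, hinj, ?_⟩, him⟩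
  · rintro i ⟨w, hw⟩
    exact ⟨w, him w ▸ Finset.mem_image_of_mem f hw⟩
  · rintro i ⟨w, hw⟩
    rw [← him w, Finset.mem_image] at hw
    obtain ⟨j, hj, rfl⟩ := hw
    exact ⟨j, ⟨w, hj⟩, rfl⟩

theorem exists_isAlternating [Fintype V] {G : SimpleGraph V} (hbip : G.IsBipartite) (k : ℕ) :
    ∃ r : V → Finset ℕ, IsAlternating G k r := by
  -- With a single vertex only `k` colours are available, too few for two disjoint sets when `k >
  -- 0`; one part is left empty.
  by_cases hV : Fintype.card V ≤ 1
  · have hsub : Subsingleton V := Fintype.card_le_one_iff_subsingleton.1 hV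
    refine ⟨fun _ => Finset.Icc 1 k, fun v => ⟨by simp, ?_⟩, Set.univ, ∅, ⟨by simp, ?_⟩, ?_⟩
    · have : 0 < Fintype.card V := Fintype.card_pos_iff.2 ⟨v⟩
      exact Finset.Icc_subset_Icc le_rfl (Nat.le_mul_of_pos_right k this)
    · refine ⟨by simp, fun u v huv => absurd (Subsingleton.elim u v) huv.ne⟩
    · simp
  · have c : G.Coloring Bool := hbip.toColoring (by simp)
    have h2 : 2 * k ≤ k * Fintype.card V := by nlinarith
    refine ⟨fun v => if c v then Finset.Icc 1 k else Finset.Icc (k + 1) (2 * k), fun v => ?_,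
      {v | c v = true}, {v | c v = false}, ⟨?_, ?_, ?_⟩, ?_, ?_, ?_⟩
    · dsimp only
      split_ifs
      · exact ⟨by simp, Finset.Icc_subset_Icc le_rfl (by omega)⟩
      · exact ⟨by rw [Nat.card_Icc]; omega, Finset.Icc_subset_Icc (by omega) h2⟩
    · ext v; simp
    · rw [Set.disjoint_left]; intro v; simp
    · intro u v huv
      have := c.valid huv
      revert this
      simp only [Set.mem_ofPred_eq]
      cases c u <;> cases c v <;> simp
    · intro u hu v hv
      simp only [Set.mem_ofPred_eq] at hu hv
      simp [hu, hv]
    · intro u hu v hv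
      simp only [Set.mem_ofPred_eq] at hu hv
      simp [hu, hv]
    · intro u hu v hv
      simp only [Set.mem_ofPred_eq] at hu hv
      simp only [hu, hv, if_true, Bool.false_eq_true, if_false]
      ext i
      simp only [Finset.mem_inter, Finset.mem_Icc, Finset.notMem_empty, iff_false]
      omega

variable [Fintype V]

/-! ### Sizes of unions over components -/

theorem le_card_compUnion {k : ℕ} {r : V → Finset ℕ} (hr : IsKRestraint k r)
    {A : Finset (Sym2 V)} (C : Comp A) : k ≤ (compUnion A r C).card := by
  obtain ⟨v, hv⟩ := comp_surjective A C
  rw [← (hr v).1]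
  exact Finset.card_le_card (subset_compUnion r hv)

theorem two_mul_le_card_compUnion {k : ℕ} {r : V → Finset ℕ} (hr : IsKRestraint k r)
    {A : Finset (Sym2 V)} {C : Comp A} {u v : V} (hu : comp A u = C) (hv : comp A v = C)
    (huv : Disjoint (r u) (r v)) : 2 * k ≤ (compUnion A r C).card := by
  rw [two_mul]
  nth_rw 1 [← (hr u).1]
  rw [← (hr v).1, ← Finset.card_union_of_disjoint huv]
  exact Finset.card_le_card (Finset.union_subset (subset_compUnion r hu) (subset_compUnion r hv))

theorem card_compUnion_le_of_unique {k : ℕ} {r : V → Finset ℕ} (hr : IsKRestraint k r)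
    {A : Finset (Sym2 V)} {C : Comp A} {v : V} (hC : ∀ w, comp A w = C ↔ w = v) :
    (compUnion A r C).card ≤ k := by
  rw [← (hr v).1]
  refine Finset.card_le_card fun i hi => ?_
  obtain ⟨w, hw, hi⟩ := mem_compUnion.1 hi
  rwa [(hC w).1 hw] at hi

theorem card_compUnion_le_of_eq_or_eq {k : ℕ} {r : V → Finset ℕ} (hr : IsKRestraint k r)
    {A : Finset (Sym2 V)} {C : Comp A} {u v : V}
    (hC : ∀ w, comp A w = C → r w = r u ∨ r w = r v) : (compUnion A r C).card ≤ 2 * k := by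
  have hsub : compUnion A r C ⊆ r u ∪ r v := by
    intro i hi
    obtain ⟨w, hw, hi⟩ := mem_compUnion.1 hi
    rcases hC w hw with h | h <;> rw [h] at hi <;> simp [hi]
  calc (compUnion A r C).card ≤ (r u ∪ r v).card := Finset.card_le_card hsub
    _ ≤ (r u).card + (r v).card := Finset.card_union_le _ _
    _ = 2 * k := by rw [(hr u).1, (hr v).1, two_mul]

/-- A locally alternating restraint minimises every union among restraints disjoint on edges. -/
theorem card_compUnion_le_of_disjoint {G : SimpleGraph V} (hconn : G.Connected) {k : ℕ}
    {r s : V → Finset ℕ} (hrk : IsKRestraint k r) (hsk : IsKRestraint k s)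
    (hr : ∀ u v, G.Adj u v → Disjoint (r u) (r v)) (hs : LocallyAlternating G s)
    {A : Finset (Sym2 V)} (hA : A ⊆ G.edgeFinset) (C : Comp A) :
    (compUnion A s C).card ≤ (compUnion A r C).card := by
  rcases comp_subsingleton_or_edge C with ⟨v, hv⟩ | ⟨u, v, huvA, _, hu, hv⟩
  · exact (card_compUnion_le_of_unique hsk hv).trans (le_card_compUnion hrk C)
  · have huv : G.Adj u v := by simpa using hA huvA
    exact (card_compUnion_le_of_eq_or_eq hsk
      fun w _ => eq_or_eq_of_adj hconn hs.eq huv w).trans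
      (two_mul_le_card_compUnion hrk hu hv (hr u v huv))

theorem card_compUnion_le_of_card_le_one {G : SimpleGraph V} {k : ℕ}
    {r s : V → Finset ℕ} (hrk : IsKRestraint k r) (hsk : IsKRestraint k s)
    (hs : ∀ u v, G.Adj u v → Disjoint (s u) (s v))
    {A : Finset (Sym2 V)} (hA : A ⊆ G.edgeFinset) (hcard : A.card ≤ 1) (C : Comp A) :
    (compUnion A r C).card ≤ (compUnion A s C).card := by
  rcases comp_subsingleton_or_edge C with ⟨v, hv⟩ | ⟨u, v, huvA, _, hu, hv⟩
  · exact (card_compUnion_le_of_unique hrk hv).trans (le_card_compUnion hsk C)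
  · have huv : G.Adj u v := by simpa using hA huvA
    have hAeq : A = {s(u, v)} :=
      Finset.eq_singleton_iff_unique_mem.2 ⟨huvA, fun e he => Finset.card_le_one.1 hcard _ he _ huvA⟩
    subst hAeq
    refine (card_compUnion_le_of_eq_or_eq hrk (u := u) (v := v) fun w hw => ?_).trans
      (two_mul_le_card_compUnion hsk hu hv (hs u v huv))
    rcases comp_singleton_eq (hw.trans hv.symm) with rfl | rfl <;> simp

theorem compPoly_empty {k : ℕ} {r s : V → Finset ℕ} (hrk : IsKRestraint k r)
    (hsk : IsKRestraint k s) : compPoly ∅ s = compPoly ∅ r := by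
  refine compPoly_eq_of_card_eq fun C => ?_
  have h : ∀ t : V → Finset ℕ, IsKRestraint k t → (compUnion ∅ t C).card = k := by
    intro t ht
    rcases comp_subsingleton_or_edge C with ⟨v, hv⟩ | ⟨u, v, huv, _⟩
    · exact le_antisymm (card_compUnion_le_of_unique ht hv) (le_card_compUnion ht C)
    · simp at huv
  rw [h s hsk, h r hrk]

/-- Each of the two restraints minimises every union, so all union sizes agree. -/
theorem LocallyAlternating.restrainedPoly_eq {G : SimpleGraph V} (hconn : G.Connected) {k : ℕ}
    {r s : V → Finset ℕ} (hrk : IsKRestraint k r) (hsk : IsKRestraint k s)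
    (hr : LocallyAlternating G r) (hs : LocallyAlternating G s) :
    restrainedPoly G r = restrainedPoly G s := by
  refine Finset.sum_congr rfl fun A hA => ?_
  rw [Finset.mem_powerset] at hA
  rw [compPoly_eq_of_card_eq fun C => le_antisymm
    (card_compUnion_le_of_disjoint hconn hsk hrk hs.disjoint hr hA C)
    (card_compUnion_le_of_disjoint hconn hrk hsk hr.disjoint hs hA C)]

/-! ### Comparison of the first coefficients that differ -/

/-- If the restraints of two adjacent vertices meet, the second coefficient is not extremal. -/
theorem eventually_pos_of_not_disjoint {G : SimpleGraph V} (hbip : G.IsBipartite) {k : ℕ}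
    {r s : V → Finset ℕ} (hrk : IsKRestraint k r) (hsk : IsKRestraint k s)
    (hs : ∀ u v, G.Adj u v → Disjoint (s u) (s v)) {u v : V} (huv : G.Adj u v)
    (hr : ¬ Disjoint (r u) (r v)) :
    ∀ᶠ x : ℕ in Filter.atTop, 0 < (restrainedPoly G s - restrainedPoly G r).eval (x : ℝ) := by
  have huvA : ({s(u, v)} : Finset (Sym2 V)) ⊆ G.edgeFinset := by simpa using huv
  have hupper := card_comp_add_le hbip huvA (j := 1) (by simp) (by omega)
  have hlower := card_le_card_comp_singleton u v
  have hn : 2 ≤ Fintype.card V := Fintype.one_lt_card_iff.2 ⟨u, v, huv.ne⟩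
  -- Here `m = n - 2`, the subleading degree for single edges; larger edge sets cancel there.
  obtain ⟨m, hm⟩ := Nat.exists_eq_add_of_le' hn
  have hcoeff : ∀ A ⊆ G.edgeFinset, 0 ≤ (-1) ^ A.card * (compPoly A s - compPoly A r).coeff m := by
    intro A hA
    by_cases h0 : A.card = 0
    · rw [Finset.card_eq_zero] at h0
      subst h0
      rw [compPoly_empty hrk hsk]
      simp
    by_cases h1 : A.card = 1
    · have := card_comp_add_le hbip hA (j := 1) (by omega) (by omega)
      have := compPoly_sub_coeff_nonneg (A := A) (r := s) (s := r) (i := m) (by omega)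
        (card_compUnion_le_of_card_le_one hrk hsk hs hA h1.le)
      rw [Polynomial.coeff_sub] at this ⊢
      rw [h1]
      linarith
    · have := card_comp_add_le hbip hA (j := 2) (by omega) (by omega)
      rw [compPoly_sub_coeff_of_le (by omega), mul_zero]
  refine eventually_eval_pos (m := m) ?_ ?_
  · rw [restrainedPoly_sub_coeff]
    refine Finset.sum_pos' (fun A hA => hcoeff A (Finset.mem_powerset.1 hA))
      ⟨{s(u, v)}, Finset.mem_powerset.2 huvA, ?_⟩
    have hlt : (compUnion {s(u, v)} r (comp {s(u, v)} v)).card <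
        (compUnion {s(u, v)} s (comp {s(u, v)} v)).card := by
      refine lt_of_lt_of_le ?_ (two_mul_le_card_compUnion hsk
        (comp_eq_of_mem (A := {s(u, v)}) (by simp)) rfl (hs u v huv))
      have hsub : compUnion {s(u, v)} r (comp {s(u, v)} v) ⊆ r u ∪ r v := by
        intro i hi
        obtain ⟨w, hw, hiw⟩ := mem_compUnion.1 hi
        rcases comp_singleton_eq hw with rfl | rfl <;> simp [hiw]
      have h1 := Finset.card_le_card hsub
      have h2 := Finset.card_union_add_card_inter (r u) (r v)
      have h3 : 0 < (r u ∩ r v).card :=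
        Finset.card_pos.2 (Finset.not_disjoint_iff_nonempty_inter.1 hr)
      rw [(hrk u).1, (hrk v).1] at h2
      omega
    have := compPoly_sub_coeff_pos (i := m) (by omega)
      (card_compUnion_le_of_card_le_one hrk hsk hs huvA (by simp)) _ hlt
    rw [Polynomial.coeff_sub] at this ⊢
    rw [Finset.card_singleton]
    linarith
  · intro i hi
    rw [restrainedPoly_sub_coeff]
    refine Finset.sum_eq_zero fun A hA => ?_
    by_cases h0 : A.card = 0
    · rw [Finset.card_eq_zero] at h0
      subst h0
      rw [compPoly_empty hrk hsk]
      simp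
    · have := card_comp_add_le hbip (Finset.mem_powerset.1 hA) (j := 1) (by omega) (by omega)
      rw [compPoly_sub_coeff_of_le (by omega), mul_zero]

/-- If the restraints are disjoint along edges but differ at two vertices with a common neighbour,
the third coefficient is not extremal. -/
theorem eventually_pos_of_ne {G : SimpleGraph V} (hconn : G.Connected) (hbip : G.IsBipartite)
    {k : ℕ} {r s : V → Finset ℕ} (hrk : IsKRestraint k r) (hsk : IsKRestraint k s)
    (hs : LocallyAlternating G s) (hr : ∀ u v, G.Adj u v → Disjoint (r u) (r v))
    {u v w : V} (huv : G.Adj u v) (hwv : G.Adj w v) (huw : r u ≠ r w) :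
    ∀ᶠ x : ℕ in Filter.atTop, 0 < (restrainedPoly G s - restrainedPoly G r).eval (x : ℝ) := by
  set A₀ : Finset (Sym2 V) := {s(u, v), s(w, v)} with hA₀
  have hne : u ≠ w := fun h => huw (by rw [h])
  have hcard : A₀.card = 2 := by
    refine Finset.card_pair ?_
    simp [hne, huv.ne]
  have hA₀G : A₀ ⊆ G.edgeFinset := by
    simp [hA₀, Finset.insert_subset_iff, huv, hwv]
  have hupper := card_comp_add_le hbip hA₀G (j := 2) (by omega) (by omega)
  have hlower : _ ≤ Fintype.card (Comp A₀) + 2 := card_le_card_comp_pair u v w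
  have hn : 3 ≤ Fintype.card V :=
    Fintype.two_lt_card_iff.2 ⟨u, v, w, huv.ne, hne, hwv.ne.symm⟩
  -- Here `m = n - 3`, the subleading degree for two edges; three or more edges leave at most `n -
  -- 3` components and cancel.
  obtain ⟨m, hm⟩ := Nat.exists_eq_add_of_le' hn
  have hsmall : ∀ A ⊆ G.edgeFinset, A.card ≤ 1 → compPoly A s = compPoly A r := by
    intro A hA h1
    exact compPoly_eq_of_card_eq fun C => le_antisymm
      (card_compUnion_le_of_disjoint hconn hrk hsk hr hs hA C)
      (card_compUnion_le_of_card_le_one hrk hsk hs.disjoint hA h1 C)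
  refine eventually_eval_pos (m := m) ?_ ?_
  · rw [restrainedPoly_sub_coeff]
    refine Finset.sum_pos' (fun A hA => ?_) ⟨A₀, Finset.mem_powerset.2 hA₀G, ?_⟩
    · rw [Finset.mem_powerset] at hA
      by_cases h1 : A.card ≤ 1
      · simp [hsmall A hA h1]
      by_cases h2 : A.card = 2
      · have := card_comp_add_le hbip hA (j := 2) (by omega) (by omega)
        have := compPoly_sub_coeff_nonneg (A := A) (r := r) (s := s) (i := m) (by omega)
          (card_compUnion_le_of_disjoint hconn hrk hsk hr hs hA)
        rw [h2]
        linarith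
      · have := card_comp_add_le hbip hA (j := 3) (by omega) (by omega)
        rw [compPoly_sub_coeff_of_le (by omega), mul_zero]
    · have hu : comp A₀ u = comp A₀ v := comp_eq_of_mem (by simp [hA₀])
      have hw : comp A₀ w = comp A₀ v := comp_eq_of_mem (by simp [hA₀])
      have hlt : (compUnion A₀ s (comp A₀ v)).card < (compUnion A₀ r (comp A₀ v)).card := by
        refine lt_of_le_of_lt (card_compUnion_le_of_eq_or_eq hsk
          fun z _ => eq_or_eq_of_adj hconn hs.eq huv z) ?_
        have hsub : r v ∪ (r u ∪ r w) ⊆ compUnion A₀ r (comp A₀ v) :=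
          Finset.union_subset (subset_compUnion r rfl)
            (Finset.union_subset (subset_compUnion r hu) (subset_compUnion r hw))
        refine lt_of_lt_of_le ?_ (Finset.card_le_card hsub)
        -- `r v` is disjoint from `r u ∪ r w`, which has more than `k` elements because two distinct
        -- `k`-sets are united.
        rw [Finset.card_union_of_disjoint
          (Finset.disjoint_union_right.2 ⟨(hr u v huv).symm, (hr w v hwv).symm⟩), (hrk v).1, two_mul]
        refine Nat.add_lt_add_left ?_ k
        by_contra hle
        have h1 : r u = r u ∪ r w :=
          Finset.eq_of_subset_of_card_le Finset.subset_union_left (by rw [(hrk u).1]; omega)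
        have h2 : r w = r u ∪ r w :=
          Finset.eq_of_subset_of_card_le Finset.subset_union_right (by rw [(hrk w).1]; omega)
        exact huw (h1.trans h2.symm)
      have := compPoly_sub_coeff_pos (i := m) (by omega)
        (card_compUnion_le_of_disjoint hconn hrk hsk hr hs hA₀G) _ hlt
      rw [hcard]
      linarith
  · intro i hi
    rw [restrainedPoly_sub_coeff]
    refine Finset.sum_eq_zero fun A hA => ?_
    rw [Finset.mem_powerset] at hA
    by_cases h1 : A.card ≤ 1
    · simp [hsmall A hA h1]
    · have := card_comp_add_le hbip hA (j := 2) (by omega) (by omega)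
      rw [compPoly_sub_coeff_of_le (by omega), mul_zero]

/-! ### From polynomials to colouring counts for large `x` -/

theorem IsKRestraint.eventually_eq_eval (G : SimpleGraph V) {k : ℕ} {r : V → Finset ℕ}
    (hr : IsKRestraint k r) :
    ∀ᶠ x : ℕ in Filter.atTop, (numPermitted G r x : ℝ) = (restrainedPoly G r).eval (x : ℝ) := by
  filter_upwards [Filter.eventually_ge_atTop (k * Fintype.card V)] with x hx
  exact numPermitted_eq_eval G fun v => (hr v).2.trans (Finset.Icc_subset_Icc le_rfl hx)

theorem eventually_numPermitted_eq {G : SimpleGraph V} (hconn : G.Connected) {k : ℕ}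
    {r s : V → Finset ℕ} (hrk : IsKRestraint k r) (hsk : IsKRestraint k s)
    (hr : LocallyAlternating G r) (hs : LocallyAlternating G s) :
    ∀ᶠ x : ℕ in Filter.atTop, numPermitted G r x = numPermitted G s x := by
  filter_upwards [hrk.eventually_eq_eval G, hsk.eventually_eq_eval G] with x h1 h2
  rw [hr.restrainedPoly_eq hconn hrk hsk hs, ← h2] at h1
  exact_mod_cast h1

theorem eventually_numPermitted_lt {G : SimpleGraph V} (hconn : G.Connected)
    (hbip : G.IsBipartite) {k : ℕ} {r s : V → Finset ℕ} (hrk : IsKRestraint k r)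
    (hsk : IsKRestraint k s) (hr : ¬ LocallyAlternating G r) (hs : LocallyAlternating G s) :
    ∀ᶠ x : ℕ in Filter.atTop, numPermitted G r x < numPermitted G s x := by
  have hpos : ∀ᶠ x : ℕ in Filter.atTop,
      0 < (restrainedPoly G s - restrainedPoly G r).eval (x : ℝ) := by
    by_cases hd : ∀ u v, G.Adj u v → Disjoint (r u) (r v)
    · have : ¬ ∀ u v w, G.Adj u v → G.Adj w v → r u = r w := fun h => hr ⟨hd, h⟩
      push Not at this
      obtain ⟨u, v, w, huv, hwv, hne⟩ := this
      exact eventually_pos_of_ne hconn hbip hrk hsk hs hd huv hwv hne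
    · push Not at hd
      obtain ⟨u, v, huv, hne⟩ := hd
      exact eventually_pos_of_not_disjoint hbip hrk hsk hs.disjoint huv hne
  filter_upwards [hrk.eventually_eq_eval G, hsk.eventually_eq_eval G, hpos] with x h1 h2 h3
  rw [Polynomial.eval_sub, ← h1, ← h2, sub_pos] at h3
  exact_mod_cast h3

/-- Finiteness lets one threshold `N` serve all competitors in `Rmax`. -/
theorem finite_isKRestraint (k : ℕ) : {r : V → Finset ℕ | IsKRestraint k r}.Finite := by
  refine (Finset.finite_toSet
    (Fintype.piFinset fun _ : V => (Finset.Icc 1 (k * Fintype.card V)).powerset)).subset ?_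
  intro r hr
  simp only [Finset.mem_coe, Fintype.mem_piFinset, Finset.mem_powerset]
  exact fun v => (hr v).2

theorem mem_Rmax_iff_locallyAlternating {G : SimpleGraph V} (hconn : G.Connected)
    (hbip : G.IsBipartite) {k : ℕ} {r s : V → Finset ℕ} (hrk : IsKRestraint k r)
    (hsk : IsKRestraint k s) (hs : LocallyAlternating G s) :
    r ∈ Rmax G k ↔ LocallyAlternating G r := by
  constructor
  · rintro ⟨_, N, hN⟩
    by_contra hr
    obtain ⟨x, hlt, hx⟩ := ((eventually_numPermitted_lt hconn hbip hrk hsk hr hs).and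
      (Filter.eventually_ge_atTop N)).exists
    exact absurd (hN x hx s hsk) (not_le.2 hlt)
  · intro hr
    have hall : ∀ᶠ x : ℕ in Filter.atTop, ∀ r' ∈ {r : V → Finset ℕ | IsKRestraint k r},
        numPermitted G r' x ≤ numPermitted G r x := by
      rw [Filter.eventually_all_finite (finite_isKRestraint k)]
      intro r' hr'k
      by_cases hr' : LocallyAlternating G r'
      · exact (eventually_numPermitted_eq hconn hr'k hrk hr' hr).mono fun x hx => hx.le
      · exact (eventually_numPermitted_lt hconn hbip hr'k hrk hr' hr).mono fun x hx => hx.le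
    obtain ⟨N, hN⟩ := Filter.eventually_atTop.1 hall
    exact ⟨hrk, N, hN⟩

end Extremal

end Restraint

theorem mainTheorem2 {V : Type*} [Fintype V] (G : SimpleGraph V) (hconn : G.Connected)
    (hbip : G.IsBipartite) (k : ℕ) :
    (∃ ralt : V → Finset ℕ, Restraint.IsAlternating G k ralt) ∧
    ∀ ralt : V → Finset ℕ, Restraint.IsAlternating G k ralt →
      ∀ r : V → Finset ℕ, Restraint.IsKRestraint k r →
        (r ∈ Restraint.Rmax G k ↔ Restraint.Equivalent G r ralt) := by
  refine ⟨Restraint.exists_isAlternating hbip k, fun ralt halt r hrk => ?_⟩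
  have hloc := halt.locallyAlternating
  rw [Restraint.mem_Rmax_iff_locallyAlternating hconn hbip hrk halt.1 hloc]
  exact ⟨fun hr => hr.equivalent hconn hrk halt.1 hloc, fun h => h.locallyAlternating hloc⟩
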